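/- Let $N\ge 1$ and $s\in(0,1)$, and let $$L^1_s(\mathbb R^N)=\Bigl\{u\in L^1_{loc}(\mathbb R^N)\,:\,\int_{\mathbb R^N}\frac{|u(x)|}{1+|x|^{N+2s}}\,dx<\infty\Bigr\}$$ (real- or complex-valued functions). For $\varphi\in C_c^\infty(\mathbb R^N)$ let $$(-\Delta)^s\varphi(x)=c_{N,s}\int_{\mathbb R^N}\frac{\varphi(x)-\varphi(x+y)+1_{B}(y)\,y\cdot\nabla\varphi(x)}{|y|^{N+2s}}\,dy = c_{N,s}\,\mathrm{PV}\!\int_{\mathbb R^N}\frac{\varphi(x)-\varphi(y)}{|x-y|^{N+2s}}\,dy,$$ where $B$ is the open unit ball and $c_{N,s}=s(1-s)\pi^{-N/2}4^s\,\Gamma(\tfrac{N+2s}{2})/\Gamma(2-s)$. Suppose that $u\in L^1_s(\mathbb R^N)$ satisfies $(-\Delta)^s u+u=0$ on $\mathbb R^N$ in the distributional sense, that is, $$\int_{\mathbb R^N}u\,\bigl[(-\Delta)^s\varphi+\varphi\bigr]\,dx=0\qquad\text{for all }\varphi\in C_c^\infty(\mathbb R^N).$$ Then $u=0$ almost everywhere.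 -/

import Mathlib

open MeasureTheory
open scoped ContDiff

noncomputable section

namespace FractionalLiouville

/-- The normalization constant of the fractional Laplacian on `ℝ^N`,
`c_{N,s} = s (1 - s) π^{-N/2} 4^s Γ((N + 2s)/2) / Γ(2 - s)`. -/
def fracConst (N : ℕ) (s : ℝ) : ℝ :=
  s * (1 - s) * Real.pi ^ (-(N : ℝ) / 2) * (4 : ℝ) ^ s *
    Real.Gamma (((N : ℝ) + 2 * s) / 2) / Real.Gamma (2 - s)

/-- The fractional Laplacian `(-Δ)^s` on test functions, `s ∈ (0,1)`, as a Lévy operator: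
`c_{N,s} ∫ (φ(x) - φ(x+y) + 1_B(y) y · ∇φ(x)) |y|^{-N-2s} dy` with `B` the open unit ball.
For `φ ∈ C_c^∞` the integral converges absolutely. The gradient term is odd in `y`, so this is
the principal value integral `c_{N,s} PV ∫ (φ(x) - φ(y)) |x-y|^{-N-2s} dy`. -/
def fracLaplacian {N : ℕ} {𝕜 : Type*} [RCLike 𝕜] (s : ℝ)
    (φ : EuclideanSpace ℝ (Fin N) → 𝕜) (x : EuclideanSpace ℝ (Fin N)) : 𝕜 :=
  fracConst N s • ∫ y : EuclideanSpace ℝ (Fin N),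
    (‖y‖ ^ (-((N : ℝ) + 2 * s))) •
      (φ x - φ (x + y) + (Metric.ball (0 : EuclideanSpace ℝ (Fin N)) 1).indicator
        (fun z => fderiv ℝ φ x z) y)

/-- The space `L^1_s(ℝ^N)`: locally integrable functions `u` with
`∫ |u(x)| / (1 + |x|^{N+2s}) dx < ∞`. -/
def MemL1s {N : ℕ} {𝕜 : Type*} [RCLike 𝕜] (s : ℝ)
    (u : EuclideanSpace ℝ (Fin N) → 𝕜) : Prop :=
  LocallyIntegrable u volume ∧
    Integrable (fun x => ‖u x‖ / (1 + ‖x‖ ^ ((N : ℝ) + 2 * s))) volume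

/-- `(-Δ)^s u + u = 0` on `ℝ^N` in the distributional sense:
`∫ u ((-Δ)^s φ + φ) dx = 0` for all `φ ∈ C_c^∞(ℝ^N)`. -/
def IsDistribSolution {N : ℕ} {𝕜 : Type*} [RCLike 𝕜] (s : ℝ)
    (u : EuclideanSpace ℝ (Fin N) → 𝕜) : Prop :=
  ∀ φ : EuclideanSpace ℝ (Fin N) → 𝕜, ContDiff ℝ ∞ φ → HasCompactSupport φ →
    ∫ x, u x * (fracLaplacian s φ x + φ x) = 0

end FractionalLiouville

end

/-! Put `p = N + 2s` and, for a test function `ρ`, let `v = ρ * u`. Testing with `z ↦ ρ (x - z)`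
makes the equation hold pointwise for `v`. Cutting the kernel at radius `ε`, with `K = ∫_{|y| ≥ ε}
|y|^(-p)`, it reads `(1 + c K) v(x) = c ∫_{|y| ≥ ε} |y|^(-p) v(x+y) dy - local error`. The kernel is
nonnegative, so norms can be taken on both sides: a maximum principle in integrated form, valid for
values in any Banach space (`mul_enorm_integral_comp_sub_smul_le`).

The resulting inequality is integrated against a weight `w` comparable to `1 / (1 + |x|^p)`, the
decay for which `∫ w |u|` is finite. Such a `w` is almost invariant under the truncated kernel:
`∫_{|y| ≥ ε} |y|^(-p) w(x+y) dy ≤ (K + δ) w(x)` for every `ε`, with `δ` as small as desired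
(`exists_weight_norm_rpow_convolution_le`). Morally `(-Δ)^s w ≥ -C w`, and dilating `w` shrinks `C`.
With `c δ = 1/2` the terms `c K` cancel, leaving `∫ w |v| ≤ o(1)` as `ε → 0`. Hence `v = 0` for
every `ρ`, and `u = 0`. -/

namespace FractionalLiouville

set_option linter.unusedSectionVars false

/-! ### Integrability of the kernel `‖y‖ ^ (-p)`. -/

section Kernel

variable {E : Type*} [NormedAddCommGroup E] [InnerProductSpace ℝ E] [FiniteDimensional ℝ E]
  [MeasurableSpace E] [BorelSpace E]

/-- The truncated second moment density of the kernel `‖y‖ ^ (-p)` is integrable. -/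
theorem integrable_min_mul_norm_rpow [Nontrivial E] {p : ℝ} (hp : (Module.finrank ℝ E : ℝ) < p)
    (hp2 : p < Module.finrank ℝ E + 2) :
    Integrable (fun y : E => min 1 (‖y‖ ^ 2) * ‖y‖ ^ (-p)) := by
  -- With `n` the dimension, polar coordinates leave `r ^ (n + 1 - p)` near `0` and `r ^ (n - 1 -
  -- p)` at infinity; the bounds `p < n + 2` and `n < p` are what these two ends need.
  rw [integrable_fun_norm_addHaar volume (f := fun r : ℝ => min 1 (r ^ 2) * r ^ (-p))]
  have hn : 1 ≤ Module.finrank ℝ E := Module.finrank_pos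
  have hcast : ((Module.finrank ℝ E - 1 : ℕ) : ℝ) = (Module.finrank ℝ E : ℝ) - 1 := by
    push_cast [hn]; ring
  have hU : Set.Ioi (0 : ℝ) = Set.Ioo 0 1 ∪ Set.Ici 1 := by
    ext x; simp only [Set.mem_Ioi, Set.mem_union, Set.mem_Ioo, Set.mem_Ici]
    constructor
    · intro h; rcases lt_or_ge x 1 with h1 | h1 <;> simp [h, h1]
    · rintro (h | h) <;> linarith
  rw [hU]
  refine IntegrableOn.union ?_ ?_
  · have h : IntegrableOn (fun x : ℝ => x ^ ((Module.finrank ℝ E : ℝ) + 1 - p)) (Set.Ioo 0 1) :=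
      (intervalIntegral.integrableOn_Ioo_rpow_iff one_pos).2 (by linarith)
    refine h.congr_fun (fun x hx => ?_) measurableSet_Ioo
    have hx0 : 0 < x := hx.1
    have : min 1 (x ^ 2) = x ^ 2 := min_eq_right (by nlinarith [hx.2])
    simp only [this, smul_eq_mul]
    rw [← Real.rpow_natCast x (_ - 1), hcast, ← Real.rpow_natCast x 2, ← Real.rpow_add hx0,
      ← Real.rpow_add hx0]
    congr 1; push_cast; ring
  · have h : IntegrableOn (fun x : ℝ => x ^ ((Module.finrank ℝ E : ℝ) - 1 - p)) (Set.Ici 1) := by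
      rw [integrableOn_Ici_iff_integrableOn_Ioi]
      exact integrableOn_Ioi_rpow_of_lt (by linarith) one_pos
    refine h.congr_fun (fun x hx => ?_) measurableSet_Ici
    have hx1 : 1 ≤ x := hx
    have hx0 : 0 < x := by linarith
    have : min 1 (x ^ 2) = 1 := min_eq_left (by nlinarith)
    simp only [this, smul_eq_mul, one_mul]
    rw [← Real.rpow_natCast x (_ - 1), hcast, ← Real.rpow_add hx0]
    congr 1

theorem measurable_norm_rpow (p : ℝ) : Measurable (fun y : E => ‖y‖ ^ p) := by fun_prop

theorem integrableOn_norm_rpow_compl_ball [Nontrivial E] {p : ℝ}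
    (hp : (Module.finrank ℝ E : ℝ) < p) (hp2 : p < Module.finrank ℝ E + 2) {ε : ℝ} (hε : 0 < ε) :
    IntegrableOn (fun y : E => ‖y‖ ^ (-p)) (Metric.ball 0 ε)ᶜ := by
  have h := ((integrable_min_mul_norm_rpow (E := E) hp hp2).const_mul
    (min 1 (ε ^ 2))⁻¹).integrableOn (s := (Metric.ball 0 ε)ᶜ)
  refine Integrable.mono' h (measurable_norm_rpow _).aestronglyMeasurable ?_
  filter_upwards [ae_restrict_mem Metric.isOpen_ball.measurableSet.compl] with y hy
  have hy' : ε ≤ ‖y‖ := by simpa using hy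
  have hk : 0 ≤ ‖y‖ ^ (-p) := by positivity
  have hm : 0 < min 1 (ε ^ 2) := lt_min one_pos (by positivity)
  rw [Real.norm_of_nonneg hk, ← mul_assoc]
  refine le_mul_of_one_le_left hk ?_
  rw [inv_mul_eq_div, one_le_div hm]
  exact min_le_min le_rfl (by gcongr)

/-- The second moments of the kernel on small balls vanish in the limit. -/
theorem tendsto_setIntegral_min_mul_norm_rpow [Nontrivial E] {p : ℝ}
    (hp : (Module.finrank ℝ E : ℝ) < p) (hp2 : p < Module.finrank ℝ E + 2) :
    Filter.Tendsto (fun n : ℕ => ∫ y in Metric.ball (0 : E) (1 / ((n : ℝ) + 1)),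
      min 1 (‖y‖ ^ 2) * ‖y‖ ^ (-p)) Filter.atTop (nhds 0) := by
  have h := Antitone.tendsto_setIntegral (μ := (volume : Measure E))
    (s := fun n : ℕ => Metric.ball (0 : E) (1 / ((n : ℝ) + 1)))
    (f := fun y : E => min 1 (‖y‖ ^ 2) * ‖y‖ ^ (-p))
    (fun n => measurableSet_ball)
    (fun m n hmn => Metric.ball_subset_ball (by gcongr))
    (integrable_min_mul_norm_rpow hp hp2).integrableOn
  have hI : (⋂ n : ℕ, Metric.ball (0 : E) (1 / ((n : ℝ) + 1))) = {0} := by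
    ext y
    simp only [Set.mem_iInter, mem_ball_zero_iff, Set.mem_singleton_iff]
    constructor
    · intro hy
      by_contra h0
      obtain ⟨n, hn⟩ := exists_nat_one_div_lt (norm_pos_iff.2 h0)
      exact absurd (hy n) (not_lt.2 hn.le)
    · rintro rfl n
      rw [norm_zero]; positivity
  rw [hI] at h
  simpa using h

end Kernel

/-! ### Pointwise estimates for the weight `(1 + ‖x‖²) ^ (-a)`. -/

section Weight

/-- Second order Taylor bound for the even part of `t ↦ (1 + t) ^ (-a)`. -/
theorem exists_one_add_rpow_add_one_sub_rpow_le (a : ℝ) :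
    ∃ C, 0 ≤ C ∧ ∀ t : ℝ, |t| ≤ 1 / 2 → (1 + t) ^ (-a) + (1 - t) ^ (-a) ≤ 2 + C * t ^ 2 := by
  set G : ℝ → ℝ := fun t => (1 + t) ^ (-a) + (1 - t) ^ (-a) with hG
  have hcd : ContDiffOn ℝ ((1 : ℕ) + 1) G (Set.Icc 0 (1 / 2)) := by
    intro t ht
    have h1 : 1 + t ≠ 0 := by linarith [ht.1]
    have h2 : 1 - t ≠ 0 := by linarith [ht.2]
    refine ContDiffAt.contDiffWithinAt ?_
    refine ContDiffAt.add ?_ ?_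
    · exact ContDiffAt.rpow_const_of_ne (by fun_prop) h1
    · exact ContDiffAt.rpow_const_of_ne (by fun_prop) h2
  obtain ⟨C, hC⟩ := exists_taylor_mean_remainder_bound (n := 1) (by norm_num) hcd
  -- `G` is even, so its linear term vanishes; evenness also reduces negative `t` to Taylor's bound
  -- on `[0, 1/2]`.
  have hd : HasDerivAt G 0 0 := by
    have h1 : HasDerivAt (fun t : ℝ => (1 + t) ^ (-a)) (1 * (-a) * (1 + 0) ^ (-a - 1)) 0 :=
      HasDerivAt.rpow_const ((hasDerivAt_id (0 : ℝ)).const_add 1) (by norm_num)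
    have h2 : HasDerivAt (fun t : ℝ => (1 - t) ^ (-a)) ((-1) * (-a) * (1 - 0) ^ (-a - 1)) 0 :=
      HasDerivAt.rpow_const ((hasDerivAt_id (0 : ℝ)).const_sub 1) (by norm_num)
    exact (h1.add h2).congr_deriv (by norm_num)
  have hdw : iteratedDerivWithin 1 G (Set.Icc 0 (1 / 2)) 0 = 0 := by
    rw [iteratedDerivWithin_one]
    exact hd.hasDerivWithinAt.derivWithin
      (uniqueDiffOn_Icc (by norm_num : (0 : ℝ) < 1 / 2) 0 (by norm_num))
  have hT : ∀ t, taylorWithinEval G 1 (Set.Icc 0 (1 / 2)) 0 t = 2 := by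
    intro t
    rw [taylorWithinEval_succ, taylor_within_zero_eval]
    rw [show (0 : ℕ) + 1 = 1 from rfl, hdw]
    simp [hG]; norm_num
  have key : ∀ t ∈ Set.Icc (0 : ℝ) (1 / 2), G t ≤ 2 + |C| * t ^ 2 := by
    intro t ht
    have h := hC t ht
    rw [hT, Real.norm_eq_abs, sub_zero] at h
    have h3 : C * t ^ 2 ≤ |C| * t ^ 2 := by gcongr; exact le_abs_self C
    have h4 := le_abs_self (G t - 2)
    norm_num at h
    linarith
  refine ⟨|C|, abs_nonneg C, fun t ht => ?_⟩
  rcases le_total 0 t with h0 | h0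
  · exact key t ⟨h0, by rwa [abs_of_nonneg h0] at ht⟩
  · have h := key (-t) ⟨by linarith, by rwa [abs_of_nonpos h0] at ht⟩
    simp only [hG, sub_neg_eq_add, neg_sq] at h
    have e : 1 + -t = 1 - t := by ring
    rw [e] at h
    linarith

variable {E : Type*} [NormedAddCommGroup E] [InnerProductSpace ℝ E]

/-- The model weight `(1 + ‖x‖²) ^ (-a)`. -/
noncomputable def weight (a : ℝ) (x : E) : ℝ := (1 + ‖x‖ ^ 2) ^ (-a)

theorem weight_pos (a : ℝ) (x : E) : 0 < weight a x := by
  unfold weight; positivity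

theorem weight_le_one {a : ℝ} (ha : 0 ≤ a) (x : E) : weight a x ≤ 1 :=
  Real.rpow_le_one_of_one_le_of_nonpos (by nlinarith [sq_nonneg ‖x‖]) (by linarith)

theorem weight_neg (a : ℝ) (x : E) : weight a (-x) = weight a x := by
  simp [weight]

theorem continuous_weight (a : ℝ) : Continuous (weight a : E → ℝ) := by
  unfold weight
  refine Continuous.rpow_const (by fun_prop) (fun x => Or.inl ?_)
  positivity

theorem weight_le_of_le {a c : ℝ} (ha : 0 ≤ a) (hc : 0 < c) {x z : E}
    (h : 1 + ‖x‖ ^ 2 ≤ c * (1 + ‖z‖ ^ 2)) : weight a z ≤ c ^ a * weight a x := by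
  unfold weight
  have hx : 0 < 1 + ‖x‖ ^ 2 := by positivity
  have hz : 0 < 1 + ‖z‖ ^ 2 := by positivity
  have h1 : (c * (1 + ‖z‖ ^ 2)) ^ (-a) ≤ (1 + ‖x‖ ^ 2) ^ (-a) :=
    Real.rpow_le_rpow_of_nonpos hx h (by linarith)
  rw [Real.mul_rpow hc.le hz.le, Real.rpow_neg hc.le, inv_mul_le_iff₀ (by positivity)] at h1
  exact h1

/-- Peetre's inequality. -/
theorem weight_add_le {a : ℝ} (ha : 0 ≤ a) (x y : E) :
    weight a (x + y) ≤ (2 * (1 + ‖y‖ ^ 2)) ^ a * weight a x := by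
  refine weight_le_of_le ha (by positivity) ?_
  have h : ‖x‖ ≤ ‖x + y‖ + ‖y‖ := by
    have := norm_sub_le (x + y) y
    simpa using this
  nlinarith [norm_nonneg x, norm_nonneg (x + y), norm_nonneg y, sq_nonneg (‖x + y‖ - ‖y‖),
    mul_nonneg (sq_nonneg ‖x + y‖) (sq_nonneg ‖y‖)]

/-- With `A = 1 + ‖x‖² + ‖y‖²` and `t = 2⟪x, y⟫ / A` one has `1 + ‖x ± y‖² = A (1 ± t)`, so the
scalar bound applies and the first-order terms cancel. The error is relative to `weight a x`, as
needed for an almost eigenfunction. -/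
theorem exists_weight_add_add_weight_sub_le {a : ℝ} (ha : 0 ≤ a) :
    ∃ C, 0 ≤ C ∧ ∀ x y : E, ‖y‖ ≤ 1 / 2 →
      weight a (x + y) + weight a (x - y) ≤ (2 + C * ‖y‖ ^ 2) * weight a x := by
  obtain ⟨C, hC0, hC⟩ := exists_one_add_rpow_add_one_sub_rpow_le a
  refine ⟨4 * C, by positivity, fun x y hy => ?_⟩
  set A : ℝ := 1 + ‖x‖ ^ 2 + ‖y‖ ^ 2 with hA
  have hx0 := norm_nonneg x
  have hy0 := norm_nonneg y
  have hA1 : 1 ≤ A := by nlinarith [sq_nonneg ‖x‖, sq_nonneg ‖y‖]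
  have hA0 : 0 < A := by linarith
  set i : ℝ := inner ℝ x y with hi
  have hcs : |i| ≤ ‖x‖ * ‖y‖ := abs_real_inner_le_norm x y
  set t : ℝ := 2 * i / A with ht
  have ht1 : |t| ≤ 1 / 2 := by
    rw [ht, abs_div, abs_of_pos hA0, div_le_iff₀ hA0, abs_mul, abs_two]
    nlinarith [sq_nonneg (‖x‖ - 1), sq_nonneg ‖y‖]
  have ht2 : t ^ 2 ≤ 4 * ‖y‖ ^ 2 := by
    rw [ht, div_pow, div_le_iff₀ (by positivity)]
    have h1 : i ^ 2 ≤ ‖x‖ ^ 2 * ‖y‖ ^ 2 := by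
      rw [← sq_abs, ← mul_pow]; gcongr
    have h2 : ‖x‖ ^ 2 ≤ A ^ 2 := by nlinarith [sq_nonneg ‖y‖]
    nlinarith [mul_le_mul_of_nonneg_right h2 (sq_nonneg ‖y‖)]
  have hb := abs_le.1 ht1
  have e1 : weight a (x + y) = A ^ (-a) * (1 + t) ^ (-a) := by
    rw [weight, ← Real.mul_rpow hA0.le (by linarith [hb.1])]
    congr 1
    rw [norm_add_sq_real, ht]; field_simp; ring
  have e2 : weight a (x - y) = A ^ (-a) * (1 - t) ^ (-a) := by
    rw [weight, ← Real.mul_rpow hA0.le (by linarith [hb.2])]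
    congr 1
    rw [norm_sub_sq_real, ht]; field_simp; ring
  rw [e1, e2, ← mul_add]
  have h3 : A ^ (-a) ≤ weight a x := by
    unfold weight
    exact Real.rpow_le_rpow_of_nonpos (by positivity) (by nlinarith [sq_nonneg ‖y‖]) (by linarith)
  have h4 : (1 + t) ^ (-a) + (1 - t) ^ (-a) ≤ 2 + 4 * C * ‖y‖ ^ 2 :=
    (hC t ht1).trans (by nlinarith)
  calc A ^ (-a) * ((1 + t) ^ (-a) + (1 - t) ^ (-a)) ≤ A ^ (-a) * (2 + 4 * C * ‖y‖ ^ 2) := by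
        gcongr
    _ ≤ weight a x * (2 + 4 * C * ‖y‖ ^ 2) := by gcongr
    _ = _ := mul_comm _ _

/-- The kernel and the weight have the same decay, so at each point one factor dominates. -/
theorem norm_rpow_mul_weight_add_le {a : ℝ} (ha : 0 ≤ a) (x y : E) (hy : 1 / 2 ≤ ‖y‖) :
    ‖y‖ ^ (-(2 * a)) * weight a (x + y) ≤
      8 ^ a * weight a x * (‖y‖ ^ (-(2 * a)) + weight a (x + y)) := by
  have hk : 0 ≤ ‖y‖ ^ (-(2 * a)) := by positivity
  have hw := weight_pos a x
  have hw' := weight_pos a (x + y)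
  have hy0 : 0 < ‖y‖ := by linarith
  -- Either `x + y` is not much smaller than `x`, and the weight there is bounded by a multiple of
  -- `weight a x`, or `‖x‖ ≤ 2‖y‖`, and the kernel is. In the second case `1 ≤ 4‖y‖²` gives `1 +
  -- ‖x‖² ≤ 8‖y‖²`, whence the constant `8`.
  rcases le_total ‖x‖ (2 * ‖x + y‖) with h | h
  · have h1 : weight a (x + y) ≤ 8 ^ a * weight a x := by
      refine weight_le_of_le ha (by norm_num) ?_
      nlinarith [norm_nonneg x, norm_nonneg (x + y)]
    calc _ ≤ ‖y‖ ^ (-(2 * a)) * (8 ^ a * weight a x) := by gcongr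
      _ = 8 ^ a * weight a x * (‖y‖ ^ (-(2 * a)) + 0) := by ring
      _ ≤ _ := by gcongr
  · have h1 : ‖y‖ ^ (-(2 * a)) ≤ 8 ^ a * weight a x := by
      have h2 : ‖x‖ ≤ ‖x + y‖ + ‖y‖ := by
        have := norm_sub_le (x + y) y
        simpa using this
      have h3 : (8 * ‖y‖ ^ 2) ^ (-a) ≤ weight a x := by
        refine Real.rpow_le_rpow_of_nonpos (by positivity) ?_ (by linarith)
        nlinarith [norm_nonneg x]
      have h4 : ‖y‖ ^ (-(2 * a)) = (‖y‖ ^ 2) ^ (-a) := by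
        rw [← Real.rpow_natCast ‖y‖ 2, ← Real.rpow_mul hy0.le]
        congr 1; push_cast; ring
      rw [h4]
      rw [Real.mul_rpow (by norm_num) (by positivity), Real.rpow_neg (by norm_num),
        inv_mul_le_iff₀ (by positivity)] at h3
      exact h3
    calc _ ≤ 8 ^ a * weight a x * weight a (x + y) := by gcongr
      _ = 8 ^ a * weight a x * (0 + weight a (x + y)) := by ring
      _ ≤ _ := by gcongr

/-- The term `2 * ‖y‖ ^ (-(2 * a))` is the one that survives as the total mass of the truncated
kernel. For `a = p / 2` the others are integrable in `y` over the whole space, with integrals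
independent of `x`. Small `y` uses the second-order bound, large `y` the equal decay of kernel and
weight. -/
theorem exists_norm_rpow_mul_weight_add_weight_le {a : ℝ} (ha : 0 < a) :
    ∃ C, 0 ≤ C ∧ ∀ x y : E,
      ‖y‖ ^ (-(2 * a)) * (weight a (x + y) + weight a (x - y)) ≤
        weight a x * (2 * ‖y‖ ^ (-(2 * a)) + C * (min 1 (‖y‖ ^ 2) * ‖y‖ ^ (-(2 * a))) +
          C * (weight a (x + y) + weight a (x - y))) := by
  obtain ⟨C, hC0, hC⟩ := exists_weight_add_add_weight_sub_le (E := E) ha.le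
  set D : ℝ := 8 ^ a with hD
  have hD0 : 0 ≤ D := by positivity
  -- For `‖y‖ ≥ 1/2` the two translates give `2 * D` copies of the kernel, while `min 1 (‖y‖ ^ 2) ≥
  -- 1/4`; hence `8 * D`.
  refine ⟨C + 8 * D, by positivity, fun x y => ?_⟩
  have hk : 0 ≤ ‖y‖ ^ (-(2 * a)) := by positivity
  set k := ‖y‖ ^ (-(2 * a)) with hkdef
  have hw := weight_pos a x
  have hw1 := weight_pos a (x + y)
  have hw2 := weight_pos a (x - y)
  rcases le_total ‖y‖ (1 / 2) with hy | hy
  · have hm : min 1 (‖y‖ ^ 2) = ‖y‖ ^ 2 := min_eq_right (by nlinarith [norm_nonneg y])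
    rw [hm]
    calc k * (weight a (x + y) + weight a (x - y))
        ≤ k * ((2 + C * ‖y‖ ^ 2) * weight a x) := by gcongr; exact hC x y hy
      _ = weight a x * (2 * k + (C + 8 * 0) * (‖y‖ ^ 2 * k) + 0) := by ring
      _ ≤ _ := by gcongr; positivity
  · have hm : 1 / 4 ≤ min 1 (‖y‖ ^ 2) := le_min (by norm_num) (by nlinarith)
    have h1 := norm_rpow_mul_weight_add_le ha.le x y hy
    have h2 := norm_rpow_mul_weight_add_le ha.le x (-y) (by rwa [norm_neg])
    rw [norm_neg, ← sub_eq_add_neg] at h2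
    rw [← hkdef] at h1 h2
    calc k * (weight a (x + y) + weight a (x - y))
        ≤ weight a x * (0 + (0 + 8 * D) * (1 / 4 * k) +
          (0 + 1 * D) * (weight a (x + y) + weight a (x - y))) := by
            rw [← hD] at h1 h2; linarith
      _ ≤ _ := by
        gcongr
        · positivity
        · norm_num

end Weight

/-! ### Dilated weights as almost eigenfunctions of the truncated kernels. -/

section ScaledWeight

variable {E : Type*} [NormedAddCommGroup E] [InnerProductSpace ℝ E] [FiniteDimensional ℝ E]
  [MeasurableSpace E] [BorelSpace E]

theorem integrable_weight {p : ℝ} (hp : (Module.finrank ℝ E : ℝ) < p) :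
    Integrable (weight (p / 2) : E → ℝ) := by
  have := integrable_rpow_neg_one_add_norm_sq (E := E) (μ := volume) hp
  simp only [neg_div] at this
  exact this

theorem exists_pos_le_one_rpow_mul_le {q : ℝ} (hq : 0 < q) (B : ℝ) {δ : ℝ} (hδ : 0 < δ) :
    ∃ l : ℝ, 0 < l ∧ l ≤ 1 ∧ l ^ q * B ≤ δ := by
  have h : Filter.Tendsto (fun l : ℝ => l ^ q * B) (nhds 0) (nhds (0 ^ q * B)) :=
    ((Real.continuousAt_rpow_const 0 q (Or.inr hq.le)).mul_const B)
  rw [Real.zero_rpow hq.ne', zero_mul] at h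
  have h1 := (h.mono_left (nhdsWithin_le_nhds (s := Set.Ioi 0))).eventually_le_const hδ
  have h2 : ∀ᶠ l : ℝ in nhdsWithin 0 (Set.Ioi 0), l ∈ Set.Ioc (0 : ℝ) 1 :=
    Ioc_mem_nhdsGT one_pos
  obtain ⟨l, hl, hl'⟩ := (h1.and h2).exists
  exact ⟨l, hl'.1, hl'.2, hl⟩

theorem setIntegral_compl_ball_comp_neg (ε : ℝ) (f : E → ℝ) :
    ∫ y in (Metric.ball 0 ε)ᶜ, f (-y) = ∫ y in (Metric.ball 0 ε)ᶜ, f y := by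
  rw [← integral_indicator measurableSet_ball.compl, ← integral_indicator measurableSet_ball.compl,
    ← integral_neg_eq_self]
  congr 1
  ext y
  simp [Set.indicator]

/-- There are weights with the decay of the kernel which are almost eigenfunctions of the truncated
nonlocal operators, uniformly in the truncation. -/
theorem exists_weight_norm_rpow_convolution_le [Nontrivial E] {p : ℝ}
    (hp : (Module.finrank ℝ E : ℝ) < p) (hp2 : p < Module.finrank ℝ E + 2) {δ : ℝ} (hδ : 0 < δ) :
    ∃ w : E → ℝ, Continuous w ∧ (∀ x, 0 < w x) ∧ (∀ x, w (-x) = w x) ∧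
      (∃ C, ∀ x, w x ≤ C * (1 + ‖x‖ ^ p)⁻¹) ∧
      (∀ L, ∃ C, 0 < C ∧ ∀ x y, ‖y‖ ≤ L → w (x + y) ≤ C * w x) ∧
      ∀ ε, 0 < ε → ∀ x,
        IntegrableOn (fun y => ‖y‖ ^ (-p) * w (x + y)) (Metric.ball 0 ε)ᶜ ∧
        ∫ y in (Metric.ball 0 ε)ᶜ, ‖y‖ ^ (-p) * w (x + y) ≤
          ((∫ y in (Metric.ball (0 : E) ε)ᶜ, ‖y‖ ^ (-p)) + δ) * w x := by
  have hp0 : 0 < p := lt_of_le_of_lt (Nat.cast_nonneg _) hp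
  have ha : 0 < p / 2 := by linarith
  have h2a : 2 * (p / 2) = p := by ring
  obtain ⟨C, hC0, hC⟩ := exists_norm_rpow_mul_weight_add_weight_le (E := E) ha
  simp only [h2a] at hC
  set m : E → ℝ := fun y => min 1 (‖y‖ ^ 2) * ‖y‖ ^ (-p) with hm
  have hmi : Integrable m := integrable_min_mul_norm_rpow hp hp2
  have hm0 : ∀ y, 0 ≤ m y := fun y => by simp only [hm]; positivity
  have hWi : Integrable (weight (p / 2) : E → ℝ) := integrable_weight hp
  -- Dilating by `l` multiplies the total error by `l ^ (p - n)`, `n` being the dimension: `l ^ p`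
  -- from the kernel and `l ^ (-n)` from the change of variables. The target is `2 * δ` because the
  -- estimate is for the sum over `y` and `-y`.
  obtain ⟨l, hl0, hl1, hl⟩ := exists_pos_le_one_rpow_mul_le (q := p - Module.finrank ℝ E)
    (by linarith) (C * (∫ y, m y) + C * (2 * ∫ y : E, weight (p / 2) y))
    (δ := 2 * δ) (by positivity)
  set w : E → ℝ := fun x => weight (p / 2) (l • x) with hw
  have hwc : Continuous w := (continuous_weight _).comp (continuous_const_smul l)
  have hwp : ∀ x, 0 < w x := fun x => weight_pos _ _
  refine ⟨w, hwc, hwp, fun x => by simp only [hw, smul_neg, weight_neg], ?_, ?_, ?_⟩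
  · refine ⟨2 * (l ^ p)⁻¹, fun x => ?_⟩
    have hlp : 0 < l ^ p := by positivity
    have hlp1 : l ^ p ≤ 1 := Real.rpow_le_one hl0.le hl1 hp0.le
    have hxp : 0 ≤ ‖x‖ ^ p := by positivity
    have h1 : l ^ p * (1 + ‖x‖ ^ p) ≤ 2 * (1 + ‖l • x‖ ^ 2) ^ (p / 2) := by
      have e1 : (1 : ℝ) ≤ (1 + ‖l • x‖ ^ 2) ^ (p / 2) :=
        Real.one_le_rpow (by nlinarith [sq_nonneg ‖l • x‖]) ha.le
      have e2 : l ^ p * ‖x‖ ^ p ≤ (1 + ‖l • x‖ ^ 2) ^ (p / 2) := by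
        rw [← Real.mul_rpow hl0.le (norm_nonneg x)]
        have : l * ‖x‖ = ‖l • x‖ := by rw [norm_smul, Real.norm_of_nonneg hl0.le]
        rw [this, ← h2a, Real.rpow_mul (norm_nonneg _), h2a]
        refine Real.rpow_le_rpow (by positivity) ?_ ha.le
        norm_num
      linarith
    simp only [hw, weight]
    rw [Real.rpow_neg (by positivity), mul_assoc, ← mul_inv, ← div_eq_mul_inv,
      inv_eq_one_div, div_le_div_iff₀ (by positivity) (by positivity)]
    linarith
  · intro L
    refine ⟨(2 * (1 + L ^ 2)) ^ (p / 2), by positivity, fun x y hy => ?_⟩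
    simp only [hw, smul_add]
    refine (weight_add_le ha.le _ _).trans ?_
    have := weight_pos (p / 2) (l • x)
    have h3 : ‖l • y‖ ≤ L := by
      rw [norm_smul, Real.norm_of_nonneg hl0.le]
      nlinarith [norm_nonneg y]
    gcongr
  · intro ε hε x
    set S : Set E := (Metric.ball 0 ε)ᶜ with hS
    have hk : IntegrableOn (fun y : E => ‖y‖ ^ (-p)) S := integrableOn_norm_rpow_compl_ball hp hp2 hε
    have hi : ∀ g : E → E, Continuous g →
        IntegrableOn (fun y => ‖y‖ ^ (-p) * w (g y)) S := by
      intro g hg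
      refine Integrable.mono' hk ((measurable_norm_rpow _).aestronglyMeasurable.mul
        (hwc.comp hg).aestronglyMeasurable) (Filter.Eventually.of_forall fun y => ?_)
      have h0 : 0 ≤ ‖y‖ ^ (-p) := by positivity
      rw [Real.norm_of_nonneg (mul_nonneg h0 (hwp _).le)]
      exact mul_le_of_le_one_right h0 (weight_le_one ha.le _)
    have hi1 := hi (fun y => x + y) (by fun_prop)
    have hi2 := hi (fun y => x - y) (by fun_prop)
    refine ⟨hi1, ?_⟩
    have hsym : ∫ y in S, ‖y‖ ^ (-p) * w (x - y) = ∫ y in S, ‖y‖ ^ (-p) * w (x + y) := by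
      rw [← setIntegral_compl_ball_comp_neg ε (fun y => ‖y‖ ^ (-p) * w (x + y))]
      simp only [norm_neg, ← sub_eq_add_neg, hS]
    have hwi : Integrable w := (integrable_comp_smul_iff volume _ hl0.ne').2 hWi
    have hmli : Integrable (fun y => m (l • y)) := (integrable_comp_smul_iff volume _ hl0.ne').2 hmi
    -- `H` is the error after dilation. Being nonnegative, it can be integrated over all of `E`,
    -- which makes the bound uniform in `ε`.
    set H : E → ℝ := fun y => l ^ p * (C * m (l • y) + C * (w (x + y) + w (x - y))) with hH
    have hwi1 : Integrable (fun y => w (x + y)) := hwi.comp_add_left x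
    have hwi2 : Integrable (fun y => w (x - y)) := hwi.comp_sub_left x
    have hHi : Integrable H :=
      ((hmli.const_mul C).add ((hwi1.add hwi2).const_mul C)).const_mul _
    have hH0 : ∀ y, 0 ≤ H y := fun y => by
      have := hm0 (l • y)
      have := hwp (x + y)
      have := hwp (x - y)
      simp only [hH]; positivity
    have hHint : ∫ y, H y ≤ 2 * δ := by
      have hwi3 : Integrable (fun y => w (x + y) + w (x - y)) := hwi1.add hwi2
      simp only [hH]
      rw [integral_const_mul, integral_add (hmli.const_mul C) (hwi3.const_mul C),
        integral_const_mul, integral_const_mul, integral_add hwi1 hwi2,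
        integral_add_left_eq_self, integral_sub_left_eq_self w volume x, ← two_mul,
        Measure.integral_comp_smul volume m l]
      simp only [hw]
      rw [Measure.integral_comp_smul volume (weight (p / 2)) l, abs_of_pos (by positivity),
        smul_eq_mul, smul_eq_mul]
      refine le_trans (le_of_eq ?_) hl
      rw [Real.rpow_sub hl0, Real.rpow_natCast]
      ring
    have hpt : ∀ y, ‖y‖ ^ (-p) * w (x + y) + ‖y‖ ^ (-p) * w (x - y) ≤
        w x * (2 * ‖y‖ ^ (-p) + H y) := by
      intro y
      have h := hC (l • x) (l • y)
      rw [← smul_add, ← smul_sub] at h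
      have e : ‖l • y‖ ^ (-p) = (l ^ p)⁻¹ * ‖y‖ ^ (-p) := by
        rw [norm_smul, Real.norm_of_nonneg hl0.le, Real.mul_rpow hl0.le (norm_nonneg _),
          Real.rpow_neg hl0.le]
      have hlp : 0 < l ^ p := by positivity
      have h' := mul_le_mul_of_nonneg_left h hlp.le
      have e2 : ‖y‖ ^ (-p) = l ^ p * ‖l • y‖ ^ (-p) := by rw [e]; field_simp
      rw [e2]
      simp only [hH, hm, hw]
      linarith
    have hfin : 2 * ∫ y in S, ‖y‖ ^ (-p) * w (x + y) ≤
        w x * (2 * (∫ y in S, ‖y‖ ^ (-p)) + 2 * δ) := by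
      calc 2 * ∫ y in S, ‖y‖ ^ (-p) * w (x + y)
          = ∫ y in S, (‖y‖ ^ (-p) * w (x + y) + ‖y‖ ^ (-p) * w (x - y)) := by
            rw [integral_add hi1 hi2, hsym, two_mul]
        _ ≤ ∫ y in S, w x * (2 * ‖y‖ ^ (-p) + H y) :=
            integral_mono (hi1.add hi2)
              (((hk.const_mul 2).add hHi.integrableOn).const_mul _) hpt
        _ = w x * (2 * (∫ y in S, ‖y‖ ^ (-p)) + ∫ y in S, H y) := by
            rw [integral_const_mul, integral_add (hk.const_mul 2) hHi.integrableOn,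
              integral_const_mul]
        _ ≤ _ := by
            have := hwp x
            gcongr
            exact (setIntegral_le_integral hHi (Filter.Eventually.of_forall hH0)).trans hHint
    linarith

end ScaledWeight

/-! ### The Lévy operator on test functions through symmetric second differences. -/

section TestFunctions

variable {E : Type*} [NormedAddCommGroup E] [InnerProductSpace ℝ E] [FiniteDimensional ℝ E]
  [MeasurableSpace E] [BorelSpace E]

/-- The symmetric second difference `2 ρ(x) - ρ(x+y) - ρ(x-y)`. -/
def secondDiff (ρ : E → ℝ) (x y : E) : ℝ := 2 * ρ x - ρ (x + y) - ρ (x - y)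

theorem exists_abs_add_sub_sub_fderiv_le {ρ : E → ℝ} (hρ : ContDiff ℝ ∞ ρ)
    (hc : HasCompactSupport ρ) :
    ∃ K, 0 ≤ K ∧ ∀ x y, |ρ (x + y) - ρ x - fderiv ℝ ρ x y| ≤ K * ‖y‖ ^ 2 := by
  obtain ⟨K, hK⟩ := ContDiff.lipschitzWith_of_hasCompactSupport (𝕂 := ℝ) (n := ∞)
    (hc.fderiv (𝕜 := ℝ)) (hρ.fderiv_right (by simp)) (by simp)
  refine ⟨K, K.2, fun x y => ?_⟩
  have h := Convex.norm_image_sub_le_of_norm_fderiv_le' (𝕜 := ℝ) (f := ρ) (C := K * ‖y‖)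
    (s := Metric.closedBall x ‖y‖) (x := x) (y := x + y) (φ := fderiv ℝ ρ x)
    (fun z _ => (hρ.differentiable (by simp)).differentiableAt)
    (fun z hz => by
      have := hK.dist_le_mul z x
      rw [dist_eq_norm] at this
      refine this.trans ?_
      gcongr
      exact hz)
    (convex_closedBall _ _) (by simp) (by simp)
  rw [add_sub_cancel_left, Real.norm_eq_abs] at h
  linarith

theorem exists_abs_le_of_hasCompactSupport {ρ : E → ℝ} (hρ : Continuous ρ)
    (hc : HasCompactSupport ρ) : ∃ M, 0 ≤ M ∧ ∀ x, |ρ x| ≤ M := by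
  obtain ⟨M, hM⟩ := hc.exists_bound_of_continuous hρ
  exact ⟨M, (abs_nonneg _).trans (hM 0), hM⟩

theorem exists_abs_secondDiff_le {ρ : E → ℝ} (hρ : ContDiff ℝ ∞ ρ) (hc : HasCompactSupport ρ) :
    ∃ C, 0 ≤ C ∧ ∀ x y, |secondDiff ρ x y| ≤ C * min 1 (‖y‖ ^ 2) := by
  obtain ⟨K, hK0, hK⟩ := exists_abs_add_sub_sub_fderiv_le hρ hc
  obtain ⟨M, hM0, hM⟩ := exists_abs_le_of_hasCompactSupport hρ.continuous hc
  refine ⟨4 * M + 2 * K, by positivity, fun x y => ?_⟩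
  rcases le_total 1 (‖y‖ ^ 2) with h | h
  · rw [min_eq_left h, secondDiff]
    have h1 := abs_le.1 (hM x)
    have h2 := abs_le.1 (hM (x + y))
    have h3 := abs_le.1 (hM (x - y))
    rw [abs_le]; constructor <;> linarith
  · rw [min_eq_right h, secondDiff]
    have h1 := abs_le.1 (hK x y)
    have h2 := abs_le.1 (hK x (-y))
    rw [← sub_eq_add_neg, map_neg, norm_neg] at h2
    have := mul_nonneg hM0 (sq_nonneg ‖y‖)
    rw [abs_le]; constructor <;> linarith

/-- The Lévy operator integral on translated and reflected test functions, in symmetric form. -/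
theorem integral_norm_rpow_mul_levy_eq [Nontrivial E] {p : ℝ}
    (hp : (Module.finrank ℝ E : ℝ) < p) (hp2 : p < Module.finrank ℝ E + 2) {ρ : E → ℝ}
    (hρ : ContDiff ℝ ∞ ρ) (hc : HasCompactSupport ρ) (t : E) :
    ∫ y : E, ‖y‖ ^ (-p) * (ρ t - ρ (t - y) +
      (Metric.ball (0 : E) 1).indicator (fun z => - fderiv ℝ ρ t z) y) =
      1 / 2 * ∫ y, ‖y‖ ^ (-p) * secondDiff ρ t y := by
  obtain ⟨K, hK0, hK⟩ := exists_abs_add_sub_sub_fderiv_le hρ hc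
  obtain ⟨M, hM0, hM⟩ := exists_abs_le_of_hasCompactSupport hρ.continuous hc
  set f : E → ℝ := fun y => ‖y‖ ^ (-p) * (ρ t - ρ (t - y) +
      (Metric.ball (0 : E) 1).indicator (fun z => - fderiv ℝ ρ t z) y) with hf
  have hρm : Measurable ρ := hρ.continuous.measurable
  have hDm : Measurable (fun z => - fderiv ℝ ρ t z) :=
    (fderiv ℝ ρ t).continuous.neg.measurable
  have hfm : Measurable f :=
    (measurable_norm_rpow _).mul ((measurable_const.sub
      (hρm.comp (measurable_const.sub measurable_id))).add (hDm.indicator measurableSet_ball))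
  have hfi : Integrable f := by
    refine Integrable.mono' ((integrable_min_mul_norm_rpow (E := E) hp hp2).const_mul (2 * M + K))
      hfm.aestronglyMeasurable (Filter.Eventually.of_forall fun y => ?_)
    have hk : 0 ≤ ‖y‖ ^ (-p) := by positivity
    rw [hf, norm_mul, Real.norm_of_nonneg hk, mul_comm, ← mul_assoc]
    refine mul_le_mul_of_nonneg_right ?_ hk
    rw [Real.norm_eq_abs]
    by_cases hy : y ∈ Metric.ball (0 : E) 1
    · rw [Set.indicator_of_mem hy]
      have hy1 : ‖y‖ < 1 := by simpa using hy
      rw [min_eq_right (by nlinarith [norm_nonneg y])]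
      have h2 := abs_le.1 (hK t (-y))
      rw [← sub_eq_add_neg, map_neg, norm_neg] at h2
      have := mul_nonneg hM0 (sq_nonneg ‖y‖)
      rw [abs_le]; constructor <;> linarith
    · rw [Set.indicator_of_notMem hy]
      have hy1 : 1 ≤ ‖y‖ := by simpa using hy
      rw [min_eq_left (by nlinarith [norm_nonneg y])]
      have h1 := abs_le.1 (hM t)
      have h3 := abs_le.1 (hM (t - y))
      rw [abs_le]; constructor <;> linarith
  -- Averaging the integrand with its reflection cancels the gradient terms and leaves half the
  -- second difference.
  have hneg : ∫ y, f (-y) = ∫ y, f y := integral_neg_eq_self f volume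
  have hsum : ∫ y, (f y + f (-y)) = ∫ y, ‖y‖ ^ (-p) * secondDiff ρ t y := by
    refine integral_congr_ae (Filter.Eventually.of_forall fun y => ?_)
    simp only [hf, norm_neg, sub_neg_eq_add, secondDiff]
    by_cases hy : y ∈ Metric.ball (0 : E) 1
    · have hy' : -y ∈ Metric.ball (0 : E) 1 := by simpa using hy
      rw [Set.indicator_of_mem hy, Set.indicator_of_mem hy', map_neg]; ring
    · have hy' : -y ∉ Metric.ball (0 : E) 1 := by simpa using hy
      rw [Set.indicator_of_notMem hy, Set.indicator_of_notMem hy']; ring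
  rw [← hsum, integral_add hfi hfi.comp_neg, hneg]; ring

/-- The reflected translates `z ↦ ρ (x - z)` are the test functions that turn the distributional
equation into a pointwise one for `ρ * u`. -/
theorem fracLaplacian_ofReal_comp_sub {𝕜 : Type*} [RCLike 𝕜] {N : ℕ} (hN : 1 ≤ N) {s : ℝ}
    (hs0 : 0 < s) (hs1 : s < 1) {ρ : EuclideanSpace ℝ (Fin N) → ℝ} (hρ : ContDiff ℝ ∞ ρ)
    (hc : HasCompactSupport ρ) (x z : EuclideanSpace ℝ (Fin N)) :
    fracLaplacian s (fun z => ((ρ (x - z) : ℝ) : 𝕜)) z =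
      ((fracConst N s / 2 * ∫ y : EuclideanSpace ℝ (Fin N),
        ‖y‖ ^ (-((N : ℝ) + 2 * s)) * secondDiff ρ (x - z) y : ℝ) : 𝕜) := by
  have : Nonempty (Fin N) := ⟨⟨0, hN⟩⟩
  have hfr : (Module.finrank ℝ (EuclideanSpace ℝ (Fin N)) : ℝ) = N := by simp
  have h := integral_norm_rpow_mul_levy_eq (E := EuclideanSpace ℝ (Fin N)) (p := (N : ℝ) + 2 * s)
    (by rw [hfr]; linarith) (by rw [hfr]; linarith) hρ hc (x - z)
  have hd : ∀ y, fderiv ℝ (fun z => ((ρ (x - z) : ℝ) : 𝕜)) z y =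
      ((-(fderiv ℝ ρ (x - z) y) : ℝ) : 𝕜) := by
    intro y
    have h1 : HasFDerivAt ρ (fderiv ℝ ρ (x - z)) (x - z) :=
      ((hρ.differentiable (by simp)).differentiableAt).hasFDerivAt
    have h2 : HasFDerivAt (fun z : EuclideanSpace ℝ (Fin N) => x - z)
      (-(ContinuousLinearMap.id ℝ (EuclideanSpace ℝ (Fin N)))) z := (hasFDerivAt_id z).const_sub x
    have h3 := (RCLike.ofRealCLM (K := 𝕜)).hasFDerivAt.comp z (h1.comp z h2)
    have h4 : HasFDerivAt (fun z => ((ρ (x - z) : ℝ) : 𝕜)) _ z := h3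
    rw [h4.fderiv]
    simp
  have hint : fracLaplacian s (fun z => ((ρ (x - z) : ℝ) : 𝕜)) z = fracConst N s •
      ∫ y : EuclideanSpace ℝ (Fin N), ((‖y‖ ^ (-((N : ℝ) + 2 * s)) * (ρ (x - z) - ρ (x - z - y) +
      (Metric.ball (0 : EuclideanSpace ℝ (Fin N)) 1).indicator
        (fun w => - fderiv ℝ ρ (x - z) w) y) : ℝ) : 𝕜) := by
    unfold fracLaplacian
    congr 2
    ext y
    by_cases hy : y ∈ Metric.ball (0 : EuclideanSpace ℝ (Fin N)) 1
    · simp only [Set.indicator_of_mem hy, hd, sub_add_eq_sub_sub]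
      rw [RCLike.real_smul_eq_coe_mul]; push_cast; ring
    · simp only [Set.indicator_of_notMem hy, sub_add_eq_sub_sub]
      rw [RCLike.real_smul_eq_coe_mul]; push_cast; ring
  rw [hint, integral_ofReal, h, RCLike.real_smul_eq_coe_mul]
  push_cast; ring

end TestFunctions

/-! ### The equation for the mollification, with truncated kernel. -/

section Mollification

variable {E : Type*} [NormedAddCommGroup E] [InnerProductSpace ℝ E] [FiniteDimensional ℝ E]
  [MeasurableSpace E] [BorelSpace E]
  {F : Type*} [NormedAddCommGroup F] [NormedSpace ℝ F] [CompleteSpace F]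

theorem integrable_comp_sub_smul {u : E → F} (hu : LocallyIntegrable u) {ρ : E → ℝ}
    (hρ : Continuous ρ) (hc : HasCompactSupport ρ) (x : E) :
    Integrable (fun z => ρ (x - z) • u z) :=
  hu.integrable_smul_left_of_hasCompactSupport (by fun_prop)
    (hc.comp_homeomorph (Homeomorph.subLeft x))

theorem continuous_integral_comp_sub_smul {u : E → F} (hu : LocallyIntegrable u) {ρ : E → ℝ}
    (hρ : Continuous ρ) (hc : HasCompactSupport ρ) :
    Continuous (fun x => ∫ z, ρ (x - z) • u z) :=
  hc.continuous_convolution_right (ContinuousLinearMap.lsmul ℝ ℝ).flip hu hρ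

theorem exists_abs_le_mul_of_hasCompactSupport {ρ w : E → ℝ} (hρ : Continuous ρ)
    (hc : HasCompactSupport ρ) (hw : Continuous w) (hw0 : ∀ x, 0 < w x) :
    ∃ M, 0 ≤ M ∧ ∀ x, |ρ x| ≤ M * w x := by
  obtain ⟨M, hM0, hM⟩ := exists_abs_le_of_hasCompactSupport (ρ := fun x => ρ x / w x)
    (hρ.div hw fun x => (hw0 x).ne') (by
      refine HasCompactSupport.mono hc (fun x hx => ?_)
      simp only [Function.mem_support] at hx ⊢
      exact fun h => hx (by simp [h]))
  refine ⟨M, hM0, fun x => ?_⟩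
  have := hM x
  rwa [abs_div, abs_of_pos (hw0 x), div_le_iff₀ (hw0 x)] at this

theorem integrable_weight_comp_sub_mul_norm {u : E → F} (hum : AEStronglyMeasurable u volume)
    {w : E → ℝ} (hwc : Continuous w) (hw0 : ∀ x, 0 < w x) (hwneg : ∀ x, w (-x) = w x)
    (hwL : ∀ L, ∃ C, 0 < C ∧ ∀ x y, ‖y‖ ≤ L → w (x + y) ≤ C * w x)
    (huw : Integrable (fun z => w z * ‖u z‖)) (x : E) :
    Integrable (fun z => w (x - z) * ‖u z‖) := by
  obtain ⟨C, hC0, hC⟩ := hwL ‖x‖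
  refine Integrable.mono' (huw.const_mul C) ?_ (Filter.Eventually.of_forall fun z => ?_)
  · exact (Continuous.aestronglyMeasurable (by fun_prop)).mul hum.norm
  · have h := hC (-z) x le_rfl
    rw [hwneg, neg_add_eq_sub] at h
    rw [Real.norm_of_nonneg (mul_nonneg (hw0 _).le (norm_nonneg _)), ← mul_assoc]
    gcongr

/-- Joint integrability behind the exchange of the truncated kernel with the mollification. -/
theorem integrable_norm_rpow_smul_comp_sub_add {u : E → F} (hum : AEStronglyMeasurable u volume)
    {w : E → ℝ} {p B : ℝ} {S : Set E}
    (hwS : ∀ x, IntegrableOn (fun y => ‖y‖ ^ (-p) * w (x + y)) S ∧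
      ∫ y in S, ‖y‖ ^ (-p) * w (x + y) ≤ B * w x)
    {ρ : E → ℝ} (hρ : Continuous ρ) {M : ℝ} (hM0 : 0 ≤ M) (hM : ∀ x, |ρ x| ≤ M * w x) {x : E}
    (hux : Integrable (fun z => w (x - z) * ‖u z‖)) :
    Integrable (fun q : E × E => (‖q.2‖ ^ (-p) * ρ (x - q.1 + q.2)) • u q.1)
      (volume.prod (volume.restrict S)) := by
  have hkm : Measurable (fun q : E × E => ‖q.2‖ ^ (-p) * ρ (x - q.1 + q.2)) :=
    ((measurable_norm_rpow (E := E) (-p)).comp measurable_snd).mul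
      (Continuous.measurable (by fun_prop))
  have hfm : AEStronglyMeasurable (fun q : E × E => (‖q.2‖ ^ (-p) * ρ (x - q.1 + q.2)) • u q.1)
      (volume.prod (volume.restrict S)) :=
    hkm.aestronglyMeasurable.smul hum.comp_fst
  have hb : ∀ t y : E, ‖‖y‖ ^ (-p) * ρ (t + y)‖ ≤ M * (‖y‖ ^ (-p) * w (t + y)) := by
    intro t y
    have hk : 0 ≤ ‖y‖ ^ (-p) := by positivity
    rw [norm_mul, Real.norm_of_nonneg hk, mul_left_comm]
    exact mul_le_mul_of_nonneg_left (hM _) hk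
  have hi : ∀ t : E, IntegrableOn (fun y => ‖y‖ ^ (-p) * ρ (t + y)) S := fun t =>
    Integrable.mono' ((hwS t).1.const_mul M) (((measurable_norm_rpow (E := E) (-p)).mul
      (Continuous.measurable (by fun_prop))).aestronglyMeasurable)
      (Filter.Eventually.of_forall (hb t))
  rw [integrable_prod_iff hfm]
  refine ⟨Filter.Eventually.of_forall fun z => (hi (x - z)).smul_const (u z), ?_⟩
  -- Since `|ρ| ≤ M * w`, the `y`-integral is at most `M * B * w (x - z)`, which is integrable
  -- against `‖u‖`.
  refine Integrable.mono' (hux.const_mul (M * B)) hfm.norm.integral_prod_right'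
    (Filter.Eventually.of_forall fun z => ?_)
  simp only [norm_smul]
  rw [Real.norm_of_nonneg (by positivity), integral_mul_const, ← mul_assoc]
  refine mul_le_mul_of_nonneg_right ?_ (norm_nonneg _)
  calc ∫ y in S, ‖‖y‖ ^ (-p) * ρ (x - z + y)‖
      ≤ ∫ y in S, M * (‖y‖ ^ (-p) * w (x - z + y)) := by
        refine integral_mono ?_ ((hwS _).1.const_mul M) (fun y => ?_)
        · exact (hi (x - z)).norm
        · exact hb (x - z) y
    _ ≤ M * B * w (x - z) := by
        rw [integral_const_mul, mul_assoc]
        exact mul_le_mul_of_nonneg_left (hwS _).2 hM0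

theorem measurable_secondDiff {ρ : E → ℝ} (hρ : Continuous ρ) :
    Measurable (fun q : E × E => secondDiff ρ q.1 q.2) :=
  Continuous.measurable (by unfold secondDiff; fun_prop)

/-- For `‖y‖ < ε ≤ 1` and `‖t‖ > r + 1`, the points `t` and `t ± y` all lie where `ρ` vanishes, so
the near-diagonal part is local, with the same support bound for all such `ε`. -/
theorem norm_setIntegral_secondDiff_le [Nontrivial E] {p : ℝ}
    (hp : (Module.finrank ℝ E : ℝ) < p) (hp2 : p < Module.finrank ℝ E + 2) {ρ : E → ℝ} {C r : ℝ}
    (hC : ∀ x y, |secondDiff ρ x y| ≤ C * min 1 (‖y‖ ^ 2))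
    (hr : ∀ x, r < ‖x‖ → ρ x = 0) {ε : ℝ} (hε1 : ε ≤ 1) (t : E) :
    ‖∫ y in Metric.ball 0 ε, ‖y‖ ^ (-p) * secondDiff ρ t y‖ ≤
      (Metric.closedBall (0 : E) (r + 1)).indicator
        (fun _ => C * ∫ y in Metric.ball (0 : E) ε, min 1 (‖y‖ ^ 2) * ‖y‖ ^ (-p)) t := by
  by_cases ht : t ∈ Metric.closedBall (0 : E) (r + 1)
  · rw [Set.indicator_of_mem ht, ← integral_const_mul]
    refine norm_integral_le_of_norm_le
      ((integrable_min_mul_norm_rpow hp hp2).const_mul C).integrableOn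
      (Filter.Eventually.of_forall fun y => ?_)
    have hk : 0 ≤ ‖y‖ ^ (-p) := by positivity
    rw [norm_mul, Real.norm_of_nonneg hk, mul_comm, ← mul_assoc]
    exact mul_le_mul_of_nonneg_right (hC t y) hk
  · rw [Set.indicator_of_notMem ht]
    have ht' : r + 1 < ‖t‖ := by simpa using ht
    have h0 : ∀ y ∈ Metric.ball (0 : E) ε, ‖y‖ ^ (-p) * secondDiff ρ t y = 0 := by
      intro y hy
      have hy' : ‖y‖ < ε := by simpa using hy
      have h1 : ‖t‖ ≤ ‖t + y‖ + ‖y‖ := by simpa using norm_sub_le (t + y) y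
      have h2 : ‖t‖ ≤ ‖t - y‖ + ‖y‖ := by simpa using norm_add_le (t - y) y
      rw [secondDiff, hr t (by linarith), hr (t + y) (by linarith), hr (t - y) (by linarith)]
      simp
    rw [setIntegral_congr_fun measurableSet_ball h0]
    simp

/-- Off the ball the kernel is integrable, so the second difference may be split; the reflection `y
↦ -y` merges its two translates. -/
theorem integral_norm_rpow_mul_secondDiff_eq [Nontrivial E] {p : ℝ}
    (hp : (Module.finrank ℝ E : ℝ) < p) (hp2 : p < Module.finrank ℝ E + 2) {ρ : E → ℝ}
    (hρ : ContDiff ℝ ∞ ρ) (hc : HasCompactSupport ρ) {ε : ℝ} (hε : 0 < ε) (t : E) :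
    ∫ y, ‖y‖ ^ (-p) * secondDiff ρ t y =
      2 * (∫ y in (Metric.ball (0 : E) ε)ᶜ, ‖y‖ ^ (-p)) * ρ t -
      2 * (∫ y in (Metric.ball (0 : E) ε)ᶜ, ‖y‖ ^ (-p) * ρ (t + y)) +
      ∫ y in Metric.ball (0 : E) ε, ‖y‖ ^ (-p) * secondDiff ρ t y := by
  obtain ⟨C, hC0, hC⟩ := exists_abs_secondDiff_le hρ hc
  obtain ⟨M, hM0, hM⟩ := exists_abs_le_of_hasCompactSupport hρ.continuous hc
  have hρc := hρ.continuous
  have hk := integrableOn_norm_rpow_compl_ball (E := E) hp hp2 hε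
  have hsd : Integrable (fun y => ‖y‖ ^ (-p) * secondDiff ρ t y) := by
    refine Integrable.mono' ((integrable_min_mul_norm_rpow (E := E) hp hp2).const_mul C)
      ((measurable_norm_rpow _).mul ((measurable_secondDiff hρc).comp
        measurable_prodMk_left)).aestronglyMeasurable (Filter.Eventually.of_forall fun y => ?_)
    have hk : 0 ≤ ‖y‖ ^ (-p) := by positivity
    rw [norm_mul, Real.norm_of_nonneg hk, mul_comm, ← mul_assoc]
    exact mul_le_mul_of_nonneg_right (hC t y) hk
  have hi : ∀ g : E → E, Continuous g →
      IntegrableOn (fun y => ‖y‖ ^ (-p) * ρ (g y)) (Metric.ball (0 : E) ε)ᶜ := by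
    intro g hg
    refine Integrable.mono' (hk.const_mul M) ((measurable_norm_rpow _).aestronglyMeasurable.mul
      (hρc.comp hg).aestronglyMeasurable) (Filter.Eventually.of_forall fun y => ?_)
    have h0 : 0 ≤ ‖y‖ ^ (-p) := by positivity
    rw [norm_mul, Real.norm_of_nonneg h0, mul_comm]
    exact mul_le_mul_of_nonneg_right (hM _) h0
  have hi1 := hi (fun y => t + y) (by fun_prop)
  have hi2 := hi (fun y => t - y) (by fun_prop)
  have hsym : ∫ y in (Metric.ball (0 : E) ε)ᶜ, ‖y‖ ^ (-p) * ρ (t - y) =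
      ∫ y in (Metric.ball (0 : E) ε)ᶜ, ‖y‖ ^ (-p) * ρ (t + y) := by
    rw [← setIntegral_compl_ball_comp_neg ε (fun y => ‖y‖ ^ (-p) * ρ (t + y))]
    simp only [norm_neg, ← sub_eq_add_neg]
  have hS : ∫ y in (Metric.ball (0 : E) ε)ᶜ, ‖y‖ ^ (-p) * secondDiff ρ t y =
      2 * (∫ y in (Metric.ball (0 : E) ε)ᶜ, ‖y‖ ^ (-p)) * ρ t -
      2 * (∫ y in (Metric.ball (0 : E) ε)ᶜ, ‖y‖ ^ (-p) * ρ (t + y)) := by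
    have e : ∀ y : E, ‖y‖ ^ (-p) * secondDiff ρ t y =
        ‖y‖ ^ (-p) * (2 * ρ t) - ‖y‖ ^ (-p) * ρ (t + y) - ‖y‖ ^ (-p) * ρ (t - y) := by
      intro y; simp only [secondDiff]; ring
    simp only [e]
    have hi3 : IntegrableOn (fun y => ‖y‖ ^ (-p) * (2 * ρ t) - ‖y‖ ^ (-p) * ρ (t + y))
      (Metric.ball (0 : E) ε)ᶜ := (hk.mul_const _).sub hi1
    rw [integral_sub hi3 hi2, integral_sub (hk.mul_const _) hi1, hsym, integral_mul_const]
    ring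
  rw [← integral_add_compl measurableSet_ball hsd, hS]
  ring

/-- The mollification of a weak solution is controlled by its average against the truncated kernel,
up to a local term which vanishes with the truncation. -/
theorem mul_enorm_integral_comp_sub_smul_le [Nontrivial E] {p : ℝ}
    (hp : (Module.finrank ℝ E : ℝ) < p) (hp2 : p < Module.finrank ℝ E + 2)
    {u : E → F} (hu : LocallyIntegrable u)
    {w : E → ℝ} (hwc : Continuous w) (hw0 : ∀ x, 0 < w x) (hwneg : ∀ x, w (-x) = w x)
    (hwL : ∀ L, ∃ C, 0 < C ∧ ∀ x y, ‖y‖ ≤ L → w (x + y) ≤ C * w x)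
    (huw : Integrable (fun z => w z * ‖u z‖)) {ε B : ℝ} (hε : 0 < ε) (hε1 : ε ≤ 1)
    (hwS : ∀ x, IntegrableOn (fun y => ‖y‖ ^ (-p) * w (x + y)) (Metric.ball 0 ε)ᶜ ∧
      ∫ y in (Metric.ball 0 ε)ᶜ, ‖y‖ ^ (-p) * w (x + y) ≤ B * w x)
    {ρ : E → ℝ} (hρ : ContDiff ℝ ∞ ρ) (hc : HasCompactSupport ρ) {C r : ℝ} (hC0 : 0 ≤ C)
    (hC : ∀ x y, |secondDiff ρ x y| ≤ C * min 1 (‖y‖ ^ 2))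
    (hr : ∀ x, r < ‖x‖ → ρ x = 0) {c : ℝ} (hc0 : 0 < c)
    (hsol : ∀ x, ∫ z, (c / 2 * (∫ y, ‖y‖ ^ (-p) * secondDiff ρ (x - z) y) + ρ (x - z)) • u z = 0)
    (x : E) :
    ENNReal.ofReal (1 + c * ∫ y in (Metric.ball (0 : E) ε)ᶜ, ‖y‖ ^ (-p)) *
        ‖∫ z, ρ (x - z) • u z‖ₑ ≤
      ENNReal.ofReal c * (∫⁻ y in (Metric.ball (0 : E) ε)ᶜ,
        ENNReal.ofReal (‖y‖ ^ (-p)) * ‖∫ z, ρ (x + y - z) • u z‖ₑ) +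
      ENNReal.ofReal (c / 2 * (C * ∫ y in Metric.ball (0 : E) ε, min 1 (‖y‖ ^ 2) * ‖y‖ ^ (-p))) *
        ∫⁻ z in Metric.closedBall x (r + 1), ‖u z‖ₑ := by
  have hρc := hρ.continuous
  have hum := hu.aestronglyMeasurable
  set S : Set E := (Metric.ball 0 ε)ᶜ with hS
  set K : ℝ := ∫ y in S, ‖y‖ ^ (-p) with hK
  have hK0 : 0 ≤ K := integral_nonneg fun y => by positivity
  set η : ℝ := ∫ y in Metric.ball (0 : E) ε, min 1 (‖y‖ ^ 2) * ‖y‖ ^ (-p) with hη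
  have hη0 : 0 ≤ η := integral_nonneg fun y => by positivity
  set v : E → F := fun x => ∫ z, ρ (x - z) • u z with hv
  obtain ⟨M, hM0, hM⟩ := exists_abs_le_mul_of_hasCompactSupport hρc hc hwc hw0
  have hP := integrable_norm_rpow_smul_comp_sub_add hum hwS hρc hM0 hM
    (integrable_weight_comp_sub_mul_norm hum hwc hw0 hwneg hwL huw x)
  have hA : Integrable (fun z => (∫ y in S, ‖y‖ ^ (-p) * ρ (x - z + y)) • u z) := by
    have := hP.integral_prod_left
    simpa only [integral_smul_const] using this
  have hAeq : ∫ z, (∫ y in S, ‖y‖ ^ (-p) * ρ (x - z + y)) • u z =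
      ∫ y in S, ‖y‖ ^ (-p) • v (x + y) := by
    have h := integral_integral_swap
      (f := fun (z y : E) => (‖y‖ ^ (-p) * ρ (x - z + y)) • u z) hP
    simp only [integral_smul_const] at h
    rw [h]
    refine integral_congr_ae (Filter.Eventually.of_forall fun y => ?_)
    simp only [mul_smul, hv]
    rw [integral_smul]
    simp only [sub_add_eq_add_sub]
  set h : E → ℝ := fun t => ∫ y in Metric.ball (0 : E) ε, ‖y‖ ^ (-p) * secondDiff ρ t y with hh
  have hhm : StronglyMeasurable h := by
    refine StronglyMeasurable.integral_prod_right
      (f := fun t y => ‖y‖ ^ (-p) * secondDiff ρ t y) (Measurable.stronglyMeasurable ?_)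
    exact ((measurable_norm_rpow (E := E) (-p)).comp measurable_snd).mul
      (measurable_secondDiff hρc)
  have hhb : ∀ z, ‖h (x - z) • u z‖ ≤
      (Metric.closedBall x (r + 1)).indicator (fun z => C * η * ‖u z‖) z := by
    intro z
    have h1 := norm_setIntegral_secondDiff_le hp hp2 hC hr hε1 (x - z)
    rw [norm_smul]
    by_cases hz : z ∈ Metric.closedBall x (r + 1)
    · have hz' : x - z ∈ Metric.closedBall (0 : E) (r + 1) := by
        rw [mem_closedBall_zero_iff, ← dist_eq_norm, dist_comm]; exact hz
      rw [Set.indicator_of_mem hz'] at h1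
      rw [Set.indicator_of_mem hz]
      exact mul_le_mul_of_nonneg_right h1 (norm_nonneg _)
    · have hz' : x - z ∉ Metric.closedBall (0 : E) (r + 1) := by
        rw [mem_closedBall_zero_iff, ← dist_eq_norm, dist_comm]; exact hz
      rw [Set.indicator_of_notMem hz'] at h1
      rw [Set.indicator_of_notMem hz]
      have : ‖h (x - z)‖ = 0 := le_antisymm h1 (norm_nonneg _)
      rw [this, zero_mul]
  have huI : IntegrableOn u (Metric.closedBall x (r + 1)) :=
    hu.integrableOn_isCompact (isCompact_closedBall _ _)
  have hH : Integrable (fun z => h (x - z) • u z) := by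
    have hb : IntegrableOn (fun z => C * η * ‖u z‖) (Metric.closedBall x (r + 1)) :=
      huI.norm.const_mul (C * η)
    refine Integrable.mono' (hb.integrable_indicator measurableSet_closedBall) ?_ (Filter.Eventually.of_forall hhb)
    exact (hhm.comp_measurable (measurable_const.sub measurable_id)).aestronglyMeasurable.smul hum
  have hV : Integrable (fun z => ρ (x - z) • u z) := integrable_comp_sub_smul hu hρc hc x
  -- The mass of the truncated kernel goes to the left with a positive coefficient, so the triangle
  -- inequality costs nothing that must later cancel.
  have heq : (1 + c * K) • v x = c • (∫ y in S, ‖y‖ ^ (-p) • v (x + y)) -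
      (c / 2) • ∫ z, h (x - z) • u z := by
    have h1 := hsol x
    have e : ∀ z, (c / 2 * (∫ y, ‖y‖ ^ (-p) * secondDiff ρ (x - z) y) + ρ (x - z)) • u z =
        (1 + c * K) • (ρ (x - z) • u z) -
          c • ((∫ y in S, ‖y‖ ^ (-p) * ρ (x - z + y)) • u z) + (c / 2) • (h (x - z) • u z) := by
      intro z
      rw [integral_norm_rpow_mul_secondDiff_eq hp hp2 hρ hc hε]
      simp only [smul_smul, ← sub_smul, ← add_smul, hh]
      congr 1
      rw [← hS, ← hK]
      ring
    have hVA : Integrable (fun z => (1 + c * K) • (ρ (x - z) • u z) -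
        c • ((∫ y in S, ‖y‖ ^ (-p) * ρ (x - z + y)) • u z)) := (hV.smul _).sub (hA.smul c)
    have hHs : Integrable (fun z => (c / 2) • (h (x - z) • u z)) := hH.smul _
    have hAs : Integrable (fun z => c • ((∫ y in S, ‖y‖ ^ (-p) * ρ (x - z + y)) • u z)) := hA.smul c
    have hVs : Integrable (fun z => (1 + c * K) • (ρ (x - z) • u z)) := hV.smul _
    simp only [e] at h1
    rw [integral_add hVA hHs, integral_sub hVs hAs, integral_smul,
      integral_smul, integral_smul, hAeq] at h1
    simp only [hv]
    rw [eq_sub_iff_add_eq, ← sub_eq_zero, ← h1]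
    abel
  have hl : ENNReal.ofReal (1 + c * K) * ‖v x‖ₑ = ‖(1 + c * K) • v x‖ₑ := by
    rw [enorm_smul, Real.enorm_of_nonneg (by positivity)]
  change ENNReal.ofReal (1 + c * K) * ‖v x‖ₑ ≤ _
  rw [hl, heq]
  refine (enorm_sub_le).trans (add_le_add ?_ ?_)
  · rw [enorm_smul, Real.enorm_of_nonneg hc0.le]
    gcongr
    refine (enorm_integral_le_lintegral_enorm _).trans (le_of_eq ?_)
    refine lintegral_congr fun y => ?_
    rw [enorm_smul, Real.enorm_of_nonneg (by positivity)]
  · rw [enorm_smul, Real.enorm_of_nonneg (by positivity), ENNReal.ofReal_mul (by positivity),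
      mul_assoc]
    gcongr
    refine (enorm_integral_le_lintegral_enorm _).trans ?_
    rw [← lintegral_const_mul' _ _ ENNReal.ofReal_ne_top,
      ← lintegral_indicator measurableSet_closedBall]
    refine lintegral_mono fun z => ?_
    have h1 := hhb z
    by_cases hz : z ∈ Metric.closedBall x (r + 1)
    · rw [Set.indicator_of_mem hz] at h1 ⊢
      rw [← ofReal_norm, ← ofReal_norm, ← ENNReal.ofReal_mul (by positivity)]
      exact ENNReal.ofReal_le_ofReal h1
    · rw [Set.indicator_of_notMem hz] at h1 ⊢
      rw [← ofReal_norm]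
      simpa using h1

end Mollification

/-! ### The weighted `L¹` estimate and the conclusion. -/

section Liouville

variable {E : Type*} [NormedAddCommGroup E] [InnerProductSpace ℝ E] [FiniteDimensional ℝ E]
  [MeasurableSpace E] [BorelSpace E]
  {F : Type*} [NormedAddCommGroup F] [NormedSpace ℝ F] [CompleteSpace F]

/-- By Tonelli, since `w x ≤ C * w z` when `‖x - z‖ ≤ L`. This one quantity controls both the local
error and the weighted norm of the mollification. -/
theorem lintegral_weight_mul_lintegral_closedBall_ne_top {u : E → F}
    (hum : AEStronglyMeasurable u volume) {w : E → ℝ} (hwc : Continuous w) (hw0 : ∀ x, 0 < w x)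
    (hwL : ∀ L, ∃ C, 0 < C ∧ ∀ x y, ‖y‖ ≤ L → w (x + y) ≤ C * w x)
    (huw : Integrable (fun z => w z * ‖u z‖)) (L : ℝ) :
    ∫⁻ x, ENNReal.ofReal (w x) * ∫⁻ z in Metric.closedBall x L, ‖u z‖ₑ ≠ ⊤ := by
  obtain ⟨C, hC0, hC⟩ := hwL L
  set g : E → ENNReal := (Metric.closedBall (0 : E) L).indicator 1 with hg
  have hgm : Measurable g := measurable_one.indicator measurableSet_closedBall
  have e1 : ∫⁻ x, ENNReal.ofReal (w x) * ∫⁻ z in Metric.closedBall x L, ‖u z‖ₑ =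
      ∫⁻ x, ∫⁻ z, ENNReal.ofReal (w x) * (g (x - z) * ‖u z‖ₑ) := by
    refine lintegral_congr fun x => ?_
    rw [← lintegral_indicator measurableSet_closedBall,
      ← lintegral_const_mul' _ _ ENNReal.ofReal_ne_top]
    refine lintegral_congr fun z => ?_
    congr 1
    have : x - z ∈ Metric.closedBall (0 : E) L ↔ z ∈ Metric.closedBall x L := by
      rw [mem_closedBall_zero_iff, ← dist_eq_norm, dist_comm]; rfl
    by_cases hz : z ∈ Metric.closedBall x L
    · rw [hg, Set.indicator_of_mem hz, Set.indicator_of_mem (this.2 hz)]; simp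
    · rw [hg, Set.indicator_of_notMem hz, Set.indicator_of_notMem (fun h => hz (this.1 h))]; simp
  have hm : AEMeasurable (Function.uncurry
      fun x z => ENNReal.ofReal (w x) * (g (x - z) * ‖u z‖ₑ)) (volume.prod volume) := by
    refine AEMeasurable.mul ?_ (AEMeasurable.mul ?_ ?_)
    · exact (ENNReal.measurable_ofReal.comp (hwc.measurable.comp measurable_fst)).aemeasurable
    · exact (hgm.comp (measurable_fst.sub measurable_snd)).aemeasurable
    · exact hum.comp_snd.enorm
  rw [e1, lintegral_lintegral_swap hm]
  have e2 : ∀ z, ∫⁻ x, ENNReal.ofReal (w x) * (g (x - z) * ‖u z‖ₑ) ≤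
      (ENNReal.ofReal C * volume (Metric.closedBall (0 : E) L)) *
        ENNReal.ofReal (w z * ‖u z‖) := by
    intro z
    calc ∫⁻ x, ENNReal.ofReal (w x) * (g (x - z) * ‖u z‖ₑ)
        ≤ ∫⁻ x, ENNReal.ofReal C * ENNReal.ofReal (w z * ‖u z‖) * g (x - z) := by
          refine lintegral_mono fun x => ?_
          by_cases hx : x - z ∈ Metric.closedBall (0 : E) L
          · have h := hC z (x - z) (by simpa using hx)
            rw [add_sub_cancel] at h
            rw [hg, Set.indicator_of_mem hx, Pi.one_apply, one_mul, mul_one, ← ofReal_norm,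
              ← ENNReal.ofReal_mul (hw0 x).le, ← ENNReal.ofReal_mul hC0.le, ← mul_assoc]
            exact ENNReal.ofReal_le_ofReal (mul_le_mul_of_nonneg_right h (norm_nonneg _))
          · rw [hg, Set.indicator_of_notMem hx]; simp
      _ = _ := by
          rw [lintegral_const_mul' _ _ (ENNReal.mul_ne_top ENNReal.ofReal_ne_top
            ENNReal.ofReal_ne_top), lintegral_sub_right_eq_self g z, hg,
            lintegral_indicator_one measurableSet_closedBall]
          ring
  refine ne_top_of_le_ne_top ?_ (lintegral_mono e2)
  rw [lintegral_const_mul' _ _ (ENNReal.mul_ne_top ENNReal.ofReal_ne_top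
    measure_closedBall_lt_top.ne)]
  exact ENNReal.mul_ne_top (ENNReal.mul_ne_top ENNReal.ofReal_ne_top
    measure_closedBall_lt_top.ne) huw.lintegral_lt_top.ne

/-- Tonelli and a translation move the truncated kernel from `v` onto `w`, where the
almost-eigenfunction bound applies. -/
theorem lintegral_weight_mul_lintegral_norm_rpow_le {w : E → ℝ} (hwc : Continuous w)
    (hw0 : ∀ x, 0 < w x) (hwneg : ∀ x, w (-x) = w x) {p B : ℝ} (hB : 0 ≤ B) {S : Set E}
    (hwS : ∀ x, IntegrableOn (fun y => ‖y‖ ^ (-p) * w (x + y)) S ∧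
      ∫ y in S, ‖y‖ ^ (-p) * w (x + y) ≤ B * w x) {v : E → F} (hv : Continuous v) :
    ∫⁻ x, ENNReal.ofReal (w x) * ∫⁻ y in S, ENNReal.ofReal (‖y‖ ^ (-p)) * ‖v (x + y)‖ₑ ≤
      ENNReal.ofReal B * ∫⁻ x, ENNReal.ofReal (w x) * ‖v x‖ₑ := by
  have hk : Measurable (fun y : E => ENNReal.ofReal (‖y‖ ^ (-p))) :=
    (measurable_norm_rpow _).ennreal_ofReal
  have hm1 : Measurable (Function.uncurry fun (x y : E) =>
      ENNReal.ofReal (w x) * (ENNReal.ofReal (‖y‖ ^ (-p)) * ‖v (x + y)‖ₑ)) := by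
    refine Measurable.mul ?_ (Measurable.mul (hk.comp measurable_snd) ?_)
    · exact (hwc.measurable.comp measurable_fst).ennreal_ofReal
    · exact Continuous.measurable (by fun_prop)
  have hm2 : Measurable (Function.uncurry fun (y x : E) =>
      ENNReal.ofReal (w (x - y)) * (ENNReal.ofReal (‖y‖ ^ (-p)) * ‖v x‖ₑ)) := by
    refine Measurable.mul ?_ (Measurable.mul (hk.comp measurable_fst) ?_)
    · exact (hwc.measurable.comp (measurable_snd.sub measurable_fst)).ennreal_ofReal
    · exact Continuous.measurable (by fun_prop)
  calc ∫⁻ x, ENNReal.ofReal (w x) * ∫⁻ y in S, ENNReal.ofReal (‖y‖ ^ (-p)) * ‖v (x + y)‖ₑ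
      = ∫⁻ x, ∫⁻ y in S, ENNReal.ofReal (w x) *
          (ENNReal.ofReal (‖y‖ ^ (-p)) * ‖v (x + y)‖ₑ) := by
        refine lintegral_congr fun x => ?_
        rw [lintegral_const_mul' _ _ ENNReal.ofReal_ne_top]
    _ = ∫⁻ y in S, ∫⁻ x, ENNReal.ofReal (w x) *
          (ENNReal.ofReal (‖y‖ ^ (-p)) * ‖v (x + y)‖ₑ) :=
        lintegral_lintegral_swap hm1.aemeasurable
    _ = ∫⁻ y in S, ∫⁻ x, ENNReal.ofReal (w (x - y)) *
          (ENNReal.ofReal (‖y‖ ^ (-p)) * ‖v x‖ₑ) := by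
        refine lintegral_congr fun y => ?_
        rw [← lintegral_sub_right_eq_self _ y]
        simp only [sub_add_cancel]
    _ = ∫⁻ x, ∫⁻ y in S, ENNReal.ofReal (w (x - y)) *
          (ENNReal.ofReal (‖y‖ ^ (-p)) * ‖v x‖ₑ) :=
        lintegral_lintegral_swap hm2.aemeasurable
    -- Evenness of `w` turns `w (x - y)` into `w (-x + y)`, so the hypothesis is used at `-x` and no
    -- symmetry of `S` is needed.
    _ = ∫⁻ x, (∫⁻ y in S, ENNReal.ofReal (‖y‖ ^ (-p) * w (-x + y))) * ‖v x‖ₑ := by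
        refine lintegral_congr fun x => ?_
        rw [← lintegral_mul_const' _ _ enorm_ne_top]
        refine lintegral_congr fun y => ?_
        rw [ENNReal.ofReal_mul (by positivity), ← hwneg (x - y),
          show -(x - y) = -x + y by abel]
        ring
    _ ≤ ∫⁻ x, ENNReal.ofReal B * (ENNReal.ofReal (w x) * ‖v x‖ₑ) := by
        refine lintegral_mono fun x => ?_
        rw [← mul_assoc, ← ENNReal.ofReal_mul hB, ← ofReal_integral_eq_lintegral_ofReal (hwS (-x)).1
          (Filter.Eventually.of_forall fun y => mul_nonneg (by positivity) (hw0 _).le)]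
        gcongr
        have := (hwS (-x)).2
        rwa [hwneg] at this
    _ = _ := lintegral_const_mul' _ _ ENNReal.ofReal_ne_top

/-- Radius `r` would suffice; `r + 1` matches the ball in the local error term. -/
theorem enorm_integral_comp_sub_smul_le {u : E → F} {ρ : E → ℝ} {M r : ℝ}
    (hM : ∀ x, |ρ x| ≤ M) (hr : ∀ x, r < ‖x‖ → ρ x = 0) (x : E) :
    ‖∫ z, ρ (x - z) • u z‖ₑ ≤
      ENNReal.ofReal M * ∫⁻ z in Metric.closedBall x (r + 1), ‖u z‖ₑ := by
  refine (enorm_integral_le_lintegral_enorm _).trans ?_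
  rw [← lintegral_const_mul' _ _ ENNReal.ofReal_ne_top,
    ← lintegral_indicator measurableSet_closedBall]
  refine lintegral_mono fun z => ?_
  rw [enorm_smul]
  by_cases hz : z ∈ Metric.closedBall x (r + 1)
  · rw [Set.indicator_of_mem hz, ← ofReal_norm (ρ _)]
    gcongr
    exact hM _
  · have hz' : r + 1 < ‖x - z‖ := by
      rw [← dist_eq_norm, dist_comm]; simpa using hz
    rw [hr _ (by linarith)]; simp

/-- A locally integrable `u` with `∫ ‖u‖ / (1 + ‖x‖ ^ p) < ∞` which solves the Lévy equation
against all translated test functions vanishes. -/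
theorem ae_eq_zero_of_forall_integral_secondDiff_eq_zero [Nontrivial E] {p : ℝ}
    (hp : (Module.finrank ℝ E : ℝ) < p) (hp2 : p < Module.finrank ℝ E + 2)
    {u : E → F} (hu : LocallyIntegrable u) (hup : Integrable (fun x => ‖u x‖ / (1 + ‖x‖ ^ p)))
    {c : ℝ} (hc0 : 0 < c)
    (hsol : ∀ ρ : E → ℝ, ContDiff ℝ ∞ ρ → HasCompactSupport ρ → ∀ x, ∫ z,
      (c / 2 * (∫ y, ‖y‖ ^ (-p) * secondDiff ρ (x - z) y) + ρ (x - z)) • u z = 0) :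
    u =ᵐ[volume] 0 := by
  have hum := hu.aestronglyMeasurable
  -- This `δ` makes `c * δ = 1/2`, so half of the zeroth-order term survives the absorption.
  obtain ⟨w, hwc, hw0, hwneg, ⟨Cw, hCw⟩, hwL, hwk⟩ :=
    exists_weight_norm_rpow_convolution_le (E := E) hp hp2 (δ := 1 / (2 * c)) (by positivity)
  have huw : Integrable (fun z => w z * ‖u z‖) := by
    refine Integrable.mono' (hup.const_mul Cw) (hwc.aestronglyMeasurable.mul hum.norm)
      (Filter.Eventually.of_forall fun z => ?_)
    rw [Real.norm_of_nonneg (mul_nonneg (hw0 _).le (norm_nonneg _))]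
    refine (mul_le_mul_of_nonneg_right (hCw z) (norm_nonneg _)).trans (le_of_eq ?_)
    ring
  refine ae_eq_zero_of_integral_contDiff_smul_eq_zero hu fun ψ hψ hψc => ?_
  -- The reflection makes `v 0` equal to `∫ ψ • u`.
  set ρ : E → ℝ := fun x => ψ (-x) with hρdef
  have hρ : ContDiff ℝ ∞ ρ := hψ.comp contDiff_neg
  have hc : HasCompactSupport ρ := hψc.comp_homeomorph (Homeomorph.neg E)
  have hρc := hρ.continuous
  set v : E → F := fun x => ∫ z, ρ (x - z) • u z with hv
  have hvc : Continuous v := continuous_integral_comp_sub_smul hu hρc hc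
  obtain ⟨C, hC0, hC⟩ := exists_abs_secondDiff_le hρ hc
  obtain ⟨M, hM0, hM⟩ := exists_abs_le_of_hasCompactSupport hρc hc
  obtain ⟨r, hr⟩ : ∃ r, ∀ x, r < ‖x‖ → ρ x = 0 := by
    obtain ⟨r, hr⟩ := hc.isCompact.isBounded.exists_norm_le
    refine ⟨r, fun x hx => ?_⟩
    by_contra h
    exact absurd (hr x (subset_tsupport _ h)) (not_le.2 hx)
  set J := ∫⁻ x, ENNReal.ofReal (w x) * ∫⁻ z in Metric.closedBall x (r + 1), ‖u z‖ₑ with hJ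
  have hJt : J ≠ ⊤ :=
    lintegral_weight_mul_lintegral_closedBall_ne_top hum hwc hw0 hwL huw (r + 1)
  set I := ∫⁻ x, ENNReal.ofReal (w x) * ‖v x‖ₑ with hI
  -- Finiteness of `I` is what permits subtracting it from both sides below.
  have hIt : I ≠ ⊤ := by
    refine ne_top_of_le_ne_top (ENNReal.mul_ne_top (ENNReal.ofReal_ne_top (r := M)) hJt) ?_
    rw [hJ, ← lintegral_const_mul' _ _ ENNReal.ofReal_ne_top]
    refine lintegral_mono fun x => ?_
    rw [mul_left_comm]
    exact mul_le_mul_right (enorm_integral_comp_sub_smul_le hM hr x) _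
  set η : ℕ → ℝ := fun n => ∫ y in Metric.ball (0 : E) (1 / ((n : ℝ) + 1)),
    min 1 (‖y‖ ^ 2) * ‖y‖ ^ (-p) with hη
  have hηlim : Filter.Tendsto η Filter.atTop (nhds 0) :=
    tendsto_setIntegral_min_mul_norm_rpow hp hp2
  have hη0 : ∀ n, 0 ≤ η n := fun n => integral_nonneg fun y => by positivity
  -- The terms `c * K`, which depend on the truncation, cancel exactly; only the local error,
  -- proportional to `η n`, remains.
  have hkey : ∀ n, I.toReal ≤ 2 * (c / 2 * (C * η n)) * J.toReal := by
    intro n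
    set ε : ℝ := 1 / ((n : ℝ) + 1) with hε
    have hε0 : 0 < ε := Nat.one_div_pos_of_nat
    have hε1 : ε ≤ 1 := by
      rw [hε, div_le_one (by positivity)]
      linarith [Nat.cast_nonneg (α := ℝ) n]
    set S : Set E := (Metric.ball 0 ε)ᶜ with hS
    set K : ℝ := ∫ y in S, ‖y‖ ^ (-p) with hK
    have hK0 : 0 ≤ K := integral_nonneg fun y => by positivity
    set D : ℝ := c / 2 * (C * η n) with hD
    have hD0 : 0 ≤ D := by have := hη0 n; positivity
    have hB0 : 0 ≤ K + 1 / (2 * c) := by positivity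
    have hpt : ∀ x, ENNReal.ofReal (1 + c * K) * ‖v x‖ₑ ≤
        ENNReal.ofReal c * (∫⁻ y in S, ENNReal.ofReal (‖y‖ ^ (-p)) * ‖v (x + y)‖ₑ) +
        ENNReal.ofReal D * ∫⁻ z in Metric.closedBall x (r + 1), ‖u z‖ₑ := fun x =>
      mul_enorm_integral_comp_sub_smul_le hp hp2 hu hwc hw0 hwneg hwL huw hε0 hε1
        (hwk ε hε0) hρ hc hC0 hC hr hc0 (hsol ρ hρ hc) x
    have hA := lintegral_weight_mul_lintegral_norm_rpow_le hwc hw0 hwneg hB0 (hwk ε hε0) hvc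
    have hAm : Measurable (fun x => ENNReal.ofReal (w x) *
        ∫⁻ y in S, ENNReal.ofReal (‖y‖ ^ (-p)) * ‖v (x + y)‖ₑ) := by
      refine hwc.measurable.ennreal_ofReal.mul (Measurable.lintegral_prod_right'
        (f := fun q : E × E => ENNReal.ofReal (‖q.2‖ ^ (-p)) * ‖v (q.1 + q.2)‖ₑ) ?_)
      exact ((measurable_norm_rpow (E := E) (-p)).comp measurable_snd).ennreal_ofReal.mul
        (Continuous.measurable (by fun_prop))
    have hint : ENNReal.ofReal (1 + c * K) * I ≤
        ENNReal.ofReal c * (ENNReal.ofReal (K + 1 / (2 * c)) * I) + ENNReal.ofReal D * J := by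
      calc ENNReal.ofReal (1 + c * K) * I
          = ∫⁻ x, ENNReal.ofReal (w x) * (ENNReal.ofReal (1 + c * K) * ‖v x‖ₑ) := by
            rw [hI, ← lintegral_const_mul' _ _ ENNReal.ofReal_ne_top]
            exact lintegral_congr fun x => mul_left_comm _ _ _
        _ ≤ ∫⁻ x, (ENNReal.ofReal c * (ENNReal.ofReal (w x) *
              ∫⁻ y in S, ENNReal.ofReal (‖y‖ ^ (-p)) * ‖v (x + y)‖ₑ) +
            ENNReal.ofReal D * (ENNReal.ofReal (w x) *
              ∫⁻ z in Metric.closedBall x (r + 1), ‖u z‖ₑ)) := by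
            refine lintegral_mono fun x => (mul_le_mul_right (hpt x) _).trans (le_of_eq ?_)
            ring
        _ = ENNReal.ofReal c * (∫⁻ x, ENNReal.ofReal (w x) *
              ∫⁻ y in S, ENNReal.ofReal (‖y‖ ^ (-p)) * ‖v (x + y)‖ₑ) + ENNReal.ofReal D * J := by
            rw [lintegral_add_left (hAm.const_mul _), lintegral_const_mul' _ _ ENNReal.ofReal_ne_top,
              lintegral_const_mul' _ _ ENNReal.ofReal_ne_top]
        _ ≤ _ := by gcongr
    have hreal := ENNReal.toReal_mono (ENNReal.add_ne_top.2
      ⟨ENNReal.mul_ne_top ENNReal.ofReal_ne_top (ENNReal.mul_ne_top ENNReal.ofReal_ne_top hIt),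
        ENNReal.mul_ne_top ENNReal.ofReal_ne_top hJt⟩) hint
    rw [ENNReal.toReal_add (ENNReal.mul_ne_top ENNReal.ofReal_ne_top
        (ENNReal.mul_ne_top ENNReal.ofReal_ne_top hIt))
        (ENNReal.mul_ne_top ENNReal.ofReal_ne_top hJt)] at hreal
    simp only [ENNReal.toReal_mul] at hreal
    rw [ENNReal.toReal_ofReal (by positivity), ENNReal.toReal_ofReal hc0.le,
      ENNReal.toReal_ofReal hB0, ENNReal.toReal_ofReal hD0] at hreal
    have e : c * ((K + 1 / (2 * c)) * I.toReal) = (c * K + 1 / 2) * I.toReal := by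
      field_simp
    rw [e] at hreal
    linarith
  have hlim : Filter.Tendsto (fun n => 2 * (c / 2 * (C * η n)) * J.toReal) Filter.atTop
      (nhds (2 * (c / 2 * (C * 0)) * J.toReal)) :=
    ((((hηlim.const_mul C).const_mul _).const_mul _).mul_const _)
  have hI0 : I.toReal ≤ 0 := by
    have := ge_of_tendsto' hlim hkey
    simpa using this
  have hI0' : I = 0 := by
    have := (ENNReal.toReal_eq_zero_iff I).1 (le_antisymm hI0 ENNReal.toReal_nonneg)
    exact this.resolve_right hIt
  have hv0 : v = 0 := by
    have hm : Measurable (fun x => ENNReal.ofReal (w x) * ‖v x‖ₑ) :=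
      hwc.measurable.ennreal_ofReal.mul (Continuous.measurable (by fun_prop))
    rw [hI, lintegral_eq_zero_iff hm] at hI0'
    refine hvc.ae_eq_iff_eq volume continuous_zero |>.1 ?_
    filter_upwards [hI0'] with x hx
    have hwx := hw0 x
    simpa [hwx.not_ge] using hx
  have := congrFun hv0 0
  simpa [hv, hρdef] using this

end Liouville

theorem fracConst_pos {N : ℕ} {s : ℝ} (hs0 : 0 < s) (hs1 : s < 1) : 0 < fracConst N s := by
  have h1 : 0 < Real.Gamma (((N : ℝ) + 2 * s) / 2) := Real.Gamma_pos_of_pos (by positivity)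
  have h2 : 0 < Real.Gamma (2 - s) := Real.Gamma_pos_of_pos (by linarith)
  have h3 : 0 < 1 - s := by linarith
  have := Real.pi_pos
  unfold fracConst
  positivity

end FractionalLiouville

theorem theorem4p1 {𝕜 : Type*} [RCLike 𝕜] (N : ℕ) (hN : 1 ≤ N) (s : ℝ) (hs0 : 0 < s) (hs1 : s < 1)
    (u : EuclideanSpace ℝ (Fin N) → 𝕜)
    (hu : FractionalLiouville.MemL1s s u)
    (hsol : FractionalLiouville.IsDistribSolution s u) :
    u =ᵐ[volume] 0 := by
  have : Nonempty (Fin N) := ⟨⟨0, hN⟩⟩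
  have hfr : (Module.finrank ℝ (EuclideanSpace ℝ (Fin N)) : ℝ) = N := by simp
  refine FractionalLiouville.ae_eq_zero_of_forall_integral_secondDiff_eq_zero
    (p := (N : ℝ) + 2 * s) (by rw [hfr]; linarith) (by rw [hfr]; linarith) hu.1 hu.2
    (FractionalLiouville.fracConst_pos (N := N) hs0 hs1) fun ρ hρ hc x => ?_
  have h := hsol (fun z => ((ρ (x - z) : ℝ) : 𝕜))
    ((RCLike.ofRealCLM (K := 𝕜)).contDiff.comp (hρ.comp (contDiff_const.sub contDiff_id)))
    ((hc.comp_homeomorph (Homeomorph.subLeft x)).comp_left RCLike.ofReal_zero)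
  rw [← h]
  refine integral_congr_ae (Filter.Eventually.of_forall fun z => ?_)
  simp only [FractionalLiouville.fracLaplacian_ofReal_comp_sub hN hs0 hs1 hρ hc]
  rw [RCLike.real_smul_eq_coe_mul, mul_comm]
  push_cast
  ring
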